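/- Let $c>0$, $I_c=[-2\sqrt c,2\sqrt c]$, and let $\sqrt{z^2-4c}$ denote the branch that is holomorphic on $\mathbb C\setminus I_c$ and asymptotic to $z$ at $\infty$. Let $Q$ be a rational function with $Q(t)>0$ for $-2\sqrt c<t<2\sqrt c$ and such that each of $\pm 2\sqrt c$ is at worst a simple pole of $1/Q$. Then $\mu(dt)=\frac{\sqrt{4c-t^2}}{Q(t)}\,dt$ on $I_c$ is a finite measure. Let $\zeta_1,\dots,\zeta_l$ be the distinct zeros of $Q$ in $\mathbb C\setminus I_c$, with multiplicities $m_1,\dots,m_l$. Then: (a) for each $j$ there is a polynomial $q_j$ of degree at most $m_j-1$ such that, for all $w\neq\zeta_j$, \[ \left.\frac{d^{m_j-1}}{dz^{m_j-1}}\left(\frac{\sqrt{z^2-4c}}{z-w}\,\frac{(z-\zeta_j)^{m_j}}{Q(z)}\right)\right|_{z=\zeta_j}=(m_j-1)!\,\frac{q_j(w)}{(\zeta_j-w)^{m_j}}; \] (b) there is a polynomial $R_Q$ such that, for every $w\in\mathbb C$ and all sufficiently large $R$ (depending on $w$), \[ R_Q(w)=\frac1{2\pi i}\oint_{|z|=R}\frac1{z-w}\,\frac{\sqrt{z^2-4c}}{Q(z)}\,dz;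 \] (c) with these (uniquely determined) polynomials, the Stieltjes transform $S_\mu(w)=\int_{\mathbb R}\frac{1}{t-w}\,\mu(dt)$ satisfies, for every $w\in\mathbb C\setminus\mathbb R$ with $Q(w)\neq0$, \[ S_\mu(w)=\pi\frac{\sqrt{w^2-4c}}{Q(w)}+\pi\sum_{j=1}^l\frac{q_j(w)}{(\zeta_j-w)^{m_j}}-\pi R_Q(w), \] where $1/Q(w)$ is read as $0$ if $w$ is a pole of $Q$. -/

import Mathlib

open MeasureTheory Polynomial Filter
open scoped ComplexOrder RatFunc

noncomputable section

/-- The closed interval `I_c = [-2√c, 2√c]`, regarded as a subset of `ℂ`. -/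
def cutInterval (c : ℝ) : Set ℂ :=
  (fun t : ℝ => (t : ℂ)) '' Set.Icc (-(2 * √c)) (2 * √c)

/-- The branch of `√(z² - 4c)` that is holomorphic on `ℂ ∖ [-2√c, 2√c]` and asymptotic to `z` at
infinity. For `z ≠ 0`, the number `1 - 4c/z²` lies in `(-∞, 0]` exactly when `z ∈ [-2√c, 2√c]`,
so the principal square root below is holomorphic off that interval. -/
def sqrtBranch (c : ℝ) (z : ℂ) : ℂ :=
  z * (1 - 4 * (c : ℂ) / z ^ 2) ^ (1 / 2 : ℂ)

/-- The value of a rational function at a point (after reduction to lowest terms). -/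
def ratEval (Q : RatFunc ℂ) (z : ℂ) : ℂ := RatFunc.eval (RingHom.id ℂ) z Q

/-- The measure `μ(dt) = (√(4c - t²) / Q(t)) dt` on `[-2√c, 2√c]`, for `Q` real on the interior
of this interval. -/
def semicircleOver (c : ℝ) (Q : RatFunc ℂ) : Measure ℝ :=
  (volume.restrict (Set.Icc (-(2 * √c)) (2 * √c))).withDensity
    fun t => ENNReal.ofReal (√(4 * c - t ^ 2) / (ratEval Q (t : ℂ)).re)

/-- The Stieltjes transform `S_μ(w) = ∫ (t - w)⁻¹ μ(dt)` of a measure on the real line. -/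
def stieltjesTransform (μ : Measure ℝ) (w : ℂ) : ℂ := resolventTransform μ w

theorem stieltjesTransform_eq (μ : Measure ℝ) (w : ℂ) :
    stieltjesTransform μ w = ∫ t : ℝ, 1 / ((t : ℂ) - w) ∂μ := by
  simp [stieltjesTransform, resolventTransform, resolvent]

open Classical in
/-- The distinct zeros of `Q` in `ℂ ∖ [-2√c, 2√c]`. -/
def zerosOff (c : ℝ) (Q : RatFunc ℂ) : Finset ℂ :=
  Q.num.roots.toFinset.filter fun ζ => ζ ∉ cutInterval c

/-- The multiplicity of `ζ` as a zero of `Q` (it is `0` if `Q` does not vanish at `ζ`), which is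
also the order of the pole of `1/Q` at `ζ`. -/
def zeroMult (Q : RatFunc ℂ) (ζ : ℂ) : ℕ := Q.num.rootMultiplicity ζ

end

/-! Write `1/Q = D/N` in lowest terms and `f(z) = √(z² - 4c)`. Everything follows from one identity
off the cut, `f D/N = S_μ/π + T + ∑ r_ζ(w)/(w - ζ)^{m_ζ}`, with `T` a polynomial and `deg r_ζ <
m_ζ`.

For `D/N = 1` this is the semicircle law, `∫ √(4c - t²)/(t - w) dt = π(f(w) - w)`
(`integral_semicircle_div_sub`), computed by `t = 2√c cos θ`. In general `D(w)N(t) - D(t)N(w) = (t -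
w)B(t, w)` with `B` a polynomial; dividing by `N(t)(t - w)` and integrating gives `f D/N = S_μ/π +
A/N` with `A` a polynomial (`exists_sqrtBranch_mul_div_eq`). On the cut, `N` can vanish only at the
endpoints, and simply. There `A` vanishes too, by the endpoint values of the semicircle transform,
so those factors cancel and partial fractions of `A/N` have poles only at the `ζ_j`.

The identity determines the rest. Multiplied by `(z - ζ)^m/(z - w)` and differentiated `m - 1` times
at `ζ`, it retains only the `r_ζ` term, so `q_ζ` is `r_ζ` up to sign. On large circles `S_μ` and the
principal parts contribute nothing, and Cauchy's formula gives `R_Q = T`. Part (c) is the identity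
solved for `S_μ`. -/

/-! ### Trigonometric integrals of Poisson kernel type -/

theorem one_sub_two_mul_cos_add_sq (v : ℂ) (θ : ℝ) :
    1 - 2 * v * Complex.cos θ + v ^ 2 =
      (1 - v * Complex.exp (θ * Complex.I)) * (1 - v * Complex.exp (-θ * Complex.I)) := by
  have h : Complex.exp (θ * Complex.I) * Complex.exp (-θ * Complex.I) = 1 := by
    rw [← Complex.exp_add]; simp
  rw [Complex.cos]
  linear_combination -v ^ 2 * h

theorem one_sub_mul_ne_zero {v z : ℂ} (hv : ‖v‖ < 1) (hz : ‖z‖ ≤ 1) : 1 - v * z ≠ 0 := by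
  intro h
  have h1 : v * z = 1 := by linear_combination -h
  have h2 : ‖v‖ * ‖z‖ = 1 := by rw [← norm_mul, h1, norm_one]
  nlinarith [norm_nonneg v, norm_nonneg z]

theorem one_sub_two_mul_cos_add_sq_ne_zero {v : ℂ} (hv : ‖v‖ < 1) (θ : ℝ) :
    1 - 2 * v * Complex.cos θ + v ^ 2 ≠ 0 := by
  rw [one_sub_two_mul_cos_add_sq]
  refine mul_ne_zero (one_sub_mul_ne_zero hv ?_) (one_sub_mul_ne_zero hv ?_)
  · rw [Complex.norm_exp_ofReal_mul_I]
  · rw [← Complex.ofReal_neg, Complex.norm_exp_ofReal_mul_I]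

/-- Cauchy's formula on the unit circle for `z ↦ 1/(1 - vz)` at the point `v`; the denominator
factors as `(1 - vz)(1 - v/z)`. -/
theorem integral_one_div_one_sub_two_mul_cos_add_sq {v : ℂ} (hv : ‖v‖ < 1) :
    ∫ θ : ℝ in 0..2 * Real.pi, 1 / (1 - 2 * v * Complex.cos θ + v ^ 2) =
      2 * Real.pi / (1 - v ^ 2) := by
  have hd : DifferentiableOn ℂ (fun z : ℂ => 1 / (1 - v * z)) (Metric.closedBall 0 1) := by
    intro z hz
    have : 1 - v * z ≠ 0 := one_sub_mul_ne_zero hv (by simpa using hz)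
    exact (by fun_prop (disch := assumption) : DifferentiableAt ℂ _ z).differentiableWithinAt
  have hC := hd.circleIntegral_sub_inv_smul (w := v) (by simpa using hv)
  have hI : (∮ z in C(0, 1), (z - v)⁻¹ • (1 / (1 - v * z))) =
      Complex.I * ∫ θ : ℝ in 0..2 * Real.pi, 1 / (1 - 2 * v * Complex.cos θ + v ^ 2) := by
    rw [circleIntegral, ← intervalIntegral.integral_const_mul]
    refine intervalIntegral.integral_congr fun θ _ => ?_
    have h : Complex.exp (θ * Complex.I) * Complex.exp (-θ * Complex.I) = 1 := by
      rw [← Complex.exp_add]; simp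
    have h1 : 1 - v * Complex.exp (θ * Complex.I) ≠ 0 :=
      one_sub_mul_ne_zero hv (by rw [Complex.norm_exp_ofReal_mul_I])
    have h2 : 1 - v * Complex.exp (-θ * Complex.I) ≠ 0 :=
      one_sub_mul_ne_zero hv (by rw [← Complex.ofReal_neg, Complex.norm_exp_ofReal_mul_I])
    have h3 : Complex.exp (θ * Complex.I) ≠ 0 := Complex.exp_ne_zero _
    have h4 : Complex.exp (θ * Complex.I) - v =
        Complex.exp (θ * Complex.I) * (1 - v * Complex.exp (-θ * Complex.I)) := by
      linear_combination v * h
    simp only [one_sub_two_mul_cos_add_sq, deriv_circleMap, circleMap_zero, smul_eq_mul,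
      Complex.ofReal_one, one_mul]
    rw [h4]
    field_simp
  have hv2 : 1 - v ^ 2 ≠ 0 := by
    rw [sq]; exact one_sub_mul_ne_zero hv hv.le
  rw [hI] at hC
  apply mul_left_cancel₀ Complex.I_ne_zero
  rw [hC, smul_eq_mul]
  field_simp

theorem continuous_one_div_one_sub_two_mul_cos_add_sq {v : ℂ} (hv : ‖v‖ < 1) :
    Continuous fun θ : ℝ => 1 / (1 - 2 * v * Complex.cos θ + v ^ 2) :=
  Continuous.div (by fun_prop) (by fun_prop) (one_sub_two_mul_cos_add_sq_ne_zero hv)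

theorem integral_cos_zero_two_pi : ∫ θ : ℝ in 0..2 * Real.pi, Complex.cos θ = 0 := by
  have h : ∀ θ : ℝ, Complex.cos θ = (Real.cos θ : ℂ) := fun θ => (Complex.ofReal_cos θ).symm
  simp only [h]
  rw [intervalIntegral.integral_ofReal]
  simp

theorem integral_sin_sq_div_zero_two_pi {v : ℂ} (hv : ‖v‖ < 1) (hv0 : v ≠ 0) :
    ∫ θ : ℝ in 0..2 * Real.pi, Complex.sin θ ^ 2 / (1 - 2 * v * Complex.cos θ + v ^ 2) =
      (Real.pi : ℂ) := by
  have hv2 : 1 - v ^ 2 ≠ 0 := by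
    rw [sq]; exact one_sub_mul_ne_zero hv hv.le
  -- Polynomial division in `cos θ`: with `P` the denominator, `4v² sin² θ = -(1 - v²)² + 2(1 + v²)P
  -- - P²`.
  have hcong : ∀ θ : ℝ, Complex.sin θ ^ 2 / (1 - 2 * v * Complex.cos θ + v ^ 2) =
      (1 / (4 * v ^ 2)) * (-(1 - v ^ 2) ^ 2 * (1 / (1 - 2 * v * Complex.cos θ + v ^ 2)) +
        ((1 + v ^ 2) + 2 * v * Complex.cos θ)) := by
    intro θ
    have h := one_sub_two_mul_cos_add_sq_ne_zero hv θ
    have hs := Complex.sin_sq_add_cos_sq θ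
    field_simp
    linear_combination 4 * v ^ 2 * hs
  have hc := continuous_one_div_one_sub_two_mul_cos_add_sq hv
  simp_rw [hcong]
  rw [intervalIntegral.integral_const_mul, intervalIntegral.integral_add,
    intervalIntegral.integral_const_mul, integral_one_div_one_sub_two_mul_cos_add_sq hv,
    intervalIntegral.integral_add, intervalIntegral.integral_const_mul, integral_cos_zero_two_pi]
  · simp only [intervalIntegral.integral_const, Complex.real_smul]
    push_cast
    field_simp
    ring
  all_goals exact Continuous.intervalIntegrable (by fun_prop) _ _

theorem integral_sin_sq_div_zero_pi {v : ℂ} (hv : ‖v‖ < 1) (hv0 : v ≠ 0) :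
    ∫ θ : ℝ in 0..Real.pi, Complex.sin θ ^ 2 / (1 - 2 * v * Complex.cos θ + v ^ 2) =
      (Real.pi : ℂ) / 2 := by
  have hc : Continuous fun θ : ℝ =>
      Complex.sin θ ^ 2 / (1 - 2 * v * Complex.cos θ + v ^ 2) :=
    Continuous.div (by fun_prop) (by fun_prop) (one_sub_two_mul_cos_add_sq_ne_zero hv)
  have h := integral_sin_sq_div_zero_two_pi hv hv0
  rw [← intervalIntegral.integral_add_adjacent_intervals (b := Real.pi)
    (hc.intervalIntegrable _ _) (hc.intervalIntegrable _ _)] at h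
  have h2 := intervalIntegral.integral_comp_sub_left (a := 0) (b := Real.pi) (fun θ : ℝ =>
      Complex.sin θ ^ 2 / (1 - 2 * v * Complex.cos θ + v ^ 2)) (2 * Real.pi)
  have h3 : 2 * Real.pi - Real.pi = Real.pi := by ring
  rw [h3, sub_zero] at h2
  rw [← h2] at h
  have h4 : ∀ θ : ℝ, Complex.sin ((2 * Real.pi - θ : ℝ) : ℂ) ^ 2 /
      (1 - 2 * v * Complex.cos ((2 * Real.pi - θ : ℝ) : ℂ) + v ^ 2) =
      Complex.sin θ ^ 2 / (1 - 2 * v * Complex.cos θ + v ^ 2) := by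
    intro θ
    rw [← Complex.ofReal_sin, ← Complex.ofReal_cos, Real.sin_two_pi_sub, Real.cos_two_pi_sub]
    simp
  simp_rw [h4] at h
  linear_combination h / 2

/-! ### The substitution `t = a cos θ` -/

theorem image_mul_cos_Icc {a : ℝ} (ha : 0 < a) :
    (fun θ => a * Real.cos θ) '' Set.Icc 0 Real.pi = Set.Icc (-a) a := by
  have : (fun θ => a * Real.cos θ) = (fun x => a * x) ∘ Real.cos := rfl
  rw [this, Set.image_comp, Real.bijOn_cos.image_eq, Set.image_mul_left_Icc ha.le (by norm_num)]
  simp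

theorem sqrt_sq_sub_mul_cos_sq {a θ : ℝ} (ha : 0 < a) (h : θ ∈ Set.Icc 0 Real.pi) :
    √(a ^ 2 - (a * Real.cos θ) ^ 2) = a * Real.sin θ := by
  have hs := Real.sin_nonneg_of_mem_Icc h
  rw [show a ^ 2 - (a * Real.cos θ) ^ 2 = (a * Real.sin θ) ^ 2 by
    linear_combination -a ^ 2 * Real.sin_sq_add_cos_sq θ]
  exact Real.sqrt_sq (by positivity)

theorem abs_deriv_mul_cos {a θ : ℝ} (ha : 0 < a) (h : θ ∈ Set.Icc 0 Real.pi) :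
    |a * -Real.sin θ| = a * Real.sin θ := by
  have hs := Real.sin_nonneg_of_mem_Icc h
  rw [mul_neg, abs_neg, abs_of_nonneg (by positivity)]

theorem hasDerivWithinAt_mul_cos (a : ℝ) (s : Set ℝ) (θ : ℝ) :
    HasDerivWithinAt (fun θ => a * Real.cos θ) (a * -Real.sin θ) s θ :=
  ((Real.hasDerivAt_cos θ).const_mul a).hasDerivWithinAt

theorem injOn_mul_cos {a : ℝ} (ha : 0 < a) :
    Set.InjOn (fun θ => a * Real.cos θ) (Set.Icc 0 Real.pi) := fun _ hx _ hy h =>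
  Real.injOn_cos hx hy (mul_left_cancel₀ ha.ne' h)

theorem integral_sqrt_mul_eq_integral_cos {a : ℝ} (ha : 0 < a) (h : ℝ → ℂ) :
    ∫ t in Set.Icc (-a) a, (√(a ^ 2 - t ^ 2) : ℂ) * h t =
      ∫ θ in 0..Real.pi, (a : ℂ) ^ 2 * Complex.sin θ ^ 2 * h (a * Real.cos θ) := by
  rw [← image_mul_cos_Icc ha, integral_image_eq_integral_abs_deriv_smul measurableSet_Icc
    (fun θ _ => hasDerivWithinAt_mul_cos a _ θ) (injOn_mul_cos ha),
    intervalIntegral.integral_of_le Real.pi_pos.le, ← integral_Icc_eq_integral_Ioc]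
  refine setIntegral_congr_fun measurableSet_Icc fun θ hθ => ?_
  simp only [abs_deriv_mul_cos ha hθ, sqrt_sq_sub_mul_cos_sq ha hθ, Complex.real_smul]
  push_cast
  ring

theorem integrableOn_one_div_sqrt {a : ℝ} (ha : 0 < a) :
    IntegrableOn (fun t => 1 / √(a ^ 2 - t ^ 2)) (Set.Icc (-a) a) := by
  rw [← image_mul_cos_Icc ha, integrableOn_image_iff_integrableOn_abs_deriv_smul measurableSet_Icc
    (fun θ _ => hasDerivWithinAt_mul_cos a _ θ) (injOn_mul_cos ha),
    integrableOn_Icc_iff_integrableOn_Ioo]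
  have h1 : IntegrableOn (fun _ : ℝ => (1 : ℝ)) (Set.Ioo 0 Real.pi) := by simp
  refine h1.congr_fun (fun θ hθ => ?_) measurableSet_Ioo
  have hθ' := Set.Ioo_subset_Icc_self hθ
  have hs := Real.sin_pos_of_mem_Ioo hθ
  simp only [abs_deriv_mul_cos ha hθ', sqrt_sq_sub_mul_cos_sq ha hθ', smul_eq_mul]
  field_simp

/-! ### The branch of the square root -/

theorem two_mul_sqrt_sq {c : ℝ} (hc : 0 < c) : (2 * √c) ^ 2 = 4 * c := by
  rw [mul_pow, Real.sq_sqrt hc.le]; norm_num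

theorem zero_mem_cutInterval (c : ℝ) : (0 : ℂ) ∈ cutInterval c :=
  ⟨0, ⟨by simp, by simp⟩, by simp⟩

theorem isClosed_cutInterval (c : ℝ) : IsClosed (cutInterval c) :=
  (isCompact_Icc.image Complex.continuous_ofReal).isClosed

theorem ne_zero_of_notMem_cutInterval {c : ℝ} {w : ℂ} (hw : w ∉ cutInterval c) : w ≠ 0 :=
  fun h => hw (h ▸ zero_mem_cutInterval c)

theorem sub_ne_zero_of_notMem_cutInterval {c : ℝ} {w : ℂ} (hw : w ∉ cutInterval c) {t : ℝ}
    (ht : t ∈ Set.Icc (-(2 * √c)) (2 * √c)) : (t : ℂ) - w ≠ 0 :=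
  fun h => hw ⟨t, ht, sub_eq_zero.1 h⟩

/-- If `1 - 4c/w² = x ≤ 0`, then `(1 - x)w² = 4c` makes `w` real with `w² ≤ 4c`, so `w` is on the
cut. -/
theorem one_sub_div_sq_mem_slitPlane {c : ℝ} (hc : 0 < c) {w : ℂ} (hw : w ∉ cutInterval c) :
    1 - 4 * (c : ℂ) / w ^ 2 ∈ Complex.slitPlane := by
  by_contra hx
  have hw0 := ne_zero_of_notMem_cutInterval hw
  rw [Complex.mem_slitPlane_iff, not_or, not_lt, not_not] at hx
  obtain ⟨hre, him⟩ := hx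
  set x := 1 - 4 * (c : ℂ) / w ^ 2 with hxdef
  have hxre : x = (x.re : ℂ) := Complex.ext (by simp) (by simp [him])
  have hmul : ((1 - x.re : ℝ) : ℂ) * w ^ 2 = ((4 * c : ℝ) : ℂ) := by
    push_cast
    rw [← hxre, hxdef]
    field_simp
    ring
  have h1 := congrArg Complex.re hmul
  have h2 := congrArg Complex.im hmul
  simp only [Complex.ofReal_re, Complex.ofReal_im, sq, Complex.mul_re, Complex.mul_im, zero_mul,
    add_zero, sub_zero] at h1 h2
  have h3 : w.re * w.im = 0 := by
    rcases mul_eq_zero.1 h2 with h | h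
    · linarith
    · linarith
  have hwim : w.im = 0 := by
    rcases mul_eq_zero.1 h3 with h | h
    · rw [h] at h1
      nlinarith [mul_self_nonneg w.im]
    · exact h
  refine hw ⟨w.re, ?_, Complex.ext (by simp) (by simp [hwim])⟩
  have h4 : w.re ^ 2 ≤ (2 * √c) ^ 2 := by
    rw [two_mul_sqrt_sq hc]
    rw [hwim] at h1
    nlinarith [mul_self_nonneg w.re]
  exact abs_le.1 (abs_le_of_sq_le_sq h4 (by positivity))

theorem continuousAt_sqrtBranch {c : ℝ} (hc : 0 < c) {w : ℂ} (hw : w ∉ cutInterval c) :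
    ContinuousAt (sqrtBranch c) w := by
  have hw0 := ne_zero_of_notMem_cutInterval hw
  have h1 : ContinuousAt (fun z : ℂ => 1 - 4 * (c : ℂ) / z ^ 2) w :=
    continuousAt_const.sub (continuousAt_const.div (by fun_prop) (pow_ne_zero 2 hw0))
  exact continuousAt_id.mul (h1.cpow continuousAt_const (one_sub_div_sq_mem_slitPlane hc hw))

theorem sqrtBranch_sq {c : ℝ} {w : ℂ} (hw : w ≠ 0) : sqrtBranch c w ^ 2 = w ^ 2 - 4 * c := by
  have h := Complex.cpow_nat_inv_pow (1 - 4 * (c : ℂ) / w ^ 2) (n := 2) two_ne_zero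
  rw [sqrtBranch, mul_pow, show (1 / 2 : ℂ) = ((2 : ℕ) : ℂ)⁻¹ by norm_num, h]
  field_simp

theorem re_cpow_half_pos {x : ℂ} (hx : x ∈ Complex.slitPlane) : 0 < (x ^ (1 / 2 : ℂ)).re := by
  have hx0 : x ≠ 0 := Complex.slitPlane_ne_zero hx
  rw [Complex.cpow_def_of_ne_zero hx0, Complex.exp_re]
  refine mul_pos (Real.exp_pos _) (Real.cos_pos_of_mem_Ioo ?_)
  have him : (Complex.log x * (1 / 2)).im = x.arg / 2 := by
    rw [show (1 / 2 : ℂ) = ((1 / 2 : ℝ) : ℂ) by norm_num, Complex.im_mul_ofReal, Complex.log_im]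
    ring
  rw [him]
  have h1 := Complex.neg_pi_lt_arg x
  have h2 := Complex.arg_le_pi x
  have h3 := (Complex.mem_slitPlane_iff_arg.1 hx).1
  have h4 : x.arg < Real.pi := lt_of_le_of_ne h2 h3
  constructor <;> linarith

/-- Here `w ± f = w(1 ± s)` with `Re s > 0`. This decides which of the two reciprocal numbers `(w ±
f)/(2√c)` lies in the unit disc. -/
theorem norm_sub_sqrtBranch_lt {c : ℝ} (hc : 0 < c) {w : ℂ} (hw : w ∉ cutInterval c) :
    ‖w - sqrtBranch c w‖ < ‖w + sqrtBranch c w‖ := by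
  have hw0 := ne_zero_of_notMem_cutInterval hw
  have hs := re_cpow_half_pos (one_sub_div_sq_mem_slitPlane hc hw)
  rw [sqrtBranch]
  set s := (1 - 4 * (c : ℂ) / w ^ 2) ^ (1 / 2 : ℂ)
  rw [show w - w * s = w * (1 - s) by ring, show w + w * s = w * (1 + s) by ring, norm_mul,
    norm_mul]
  refine mul_lt_mul_of_pos_left ?_ (norm_pos_iff.2 hw0)
  rw [← sq_lt_sq₀ (norm_nonneg _) (norm_nonneg _), ← Complex.normSq_eq_norm_sq,
    ← Complex.normSq_eq_norm_sq, Complex.normSq_apply, Complex.normSq_apply]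
  simp only [Complex.sub_re, Complex.one_re, Complex.sub_im, Complex.one_im, Complex.add_re,
    Complex.add_im]
  nlinarith

/-! ### Semicircle integrals off the cut and at its endpoints -/

/-- The Stieltjes transform of the semicircular density off its support. -/
theorem integral_semicircle_div_sub {c : ℝ} (hc : 0 < c) {w : ℂ} (hw : w ∉ cutInterval c) :
    ∫ t in Set.Icc (-(2 * √c)) (2 * √c), (√(4 * c - t ^ 2) : ℂ) * (1 / ((t : ℂ) - w)) =
      Real.pi * (sqrtBranch c w - w) := by
  have hw0 := ne_zero_of_notMem_cutInterval hw
  have ha : 0 < 2 * √c := by positivity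
  have hac := two_mul_sqrt_sq hc
  have hsub (t : ℝ) (ht : t ∈ Set.Icc (-(2 * √c)) (2 * √c)) :=
    sub_ne_zero_of_notMem_cutInterval hw ht
  rw [← hac, integral_sqrt_mul_eq_integral_cos ha]
  have hf2 := sqrtBranch_sq (c := c) hw0
  have hlt := norm_sub_sqrtBranch_lt hc hw
  have hac' : ((2 * √c : ℝ) : ℂ) ^ 2 = 4 * c := by exact_mod_cast hac
  set a := 2 * √c
  set f := sqrtBranch c w
  have ha0 : (a : ℂ) ≠ 0 := by exact_mod_cast ha.ne'
  have hprod : (w - f) * (w + f) = a ^ 2 := by rw [hac']; linear_combination -hf2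
  have hwf : w - f ≠ 0 := fun h => by
    rw [h, zero_mul] at hprod
    exact pow_ne_zero 2 ha0 hprod.symm
  -- The parameter `v = (w - f)/a` solves `a(v + 1/v) = 2w`, so `a²(1 - 2v cos θ + v²)` is a
  -- multiple of `a cos θ - w`.
  have hnorm : ‖(w - f) / a‖ < 1 := by
    have h1 : ‖w - f‖ * ‖w + f‖ = a ^ 2 := by
      rw [← norm_mul, hprod]; simp
    rw [norm_div, Complex.norm_real, Real.norm_of_nonneg ha.le, div_lt_one ha]
    nlinarith [norm_pos_iff.2 hwf]
  have hI := integral_sin_sq_div_zero_pi hnorm (div_ne_zero hwf ha0)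
  have hcong : ∀ θ ∈ Set.uIcc 0 Real.pi, (a : ℂ) ^ 2 * Complex.sin (θ : ℝ) ^ 2 *
      (1 / (((a * Real.cos θ : ℝ) : ℂ) - w)) = -2 * (w - f) * (Complex.sin θ ^ 2 /
        (1 - 2 * ((w - f) / a) * Complex.cos θ + ((w - f) / a) ^ 2)) := by
    intro θ hθ
    rw [Set.uIcc_of_le Real.pi_pos.le] at hθ
    have h1 := hsub (a * Real.cos θ) (by
      rw [← image_mul_cos_Icc ha]; exact ⟨θ, hθ, rfl⟩)
    have h2 := one_sub_two_mul_cos_add_sq_ne_zero hnorm θ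
    have h3 : (a : ℂ) ^ 2 * (1 - 2 * ((w - f) / a) * Complex.cos θ + ((w - f) / a) ^ 2) =
        -2 * (w - f) * (((a * Real.cos θ : ℝ) : ℂ) - w) := by
      push_cast
      field_simp
      linear_combination -hprod
    rw [mul_one_div, ← mul_div_assoc, div_eq_div_iff h1 h2]
    linear_combination Complex.sin θ ^ 2 * h3
  rw [intervalIntegral.integral_congr hcong, intervalIntegral.integral_const_mul, hI]
  ring

/-- The Stieltjes transform of the semicircular density at the endpoints of its support. -/
theorem integral_semicircle_div_sub_endpoint {c : ℝ} (hc : 0 < c) {e : ℝ} (he : e ^ 2 = 4 * c) :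
    ∫ t in Set.Icc (-(2 * √c)) (2 * √c), (√(4 * c - t ^ 2) : ℂ) * (1 / ((t : ℂ) - e)) =
      -(Real.pi * e) := by
  have ha : 0 < 2 * √c := by positivity
  have hac := two_mul_sqrt_sq hc
  rw [← hac, integral_sqrt_mul_eq_integral_cos ha]
  rw [← hac] at he
  set a := 2 * √c
  -- Uses `a² sin² θ = e² - (a cos θ)²`. The interval must be open: where `a cos θ = e`, the left
  -- side is `0` by the convention `1/0 = 0`.
  have hcong : ∀ θ ∈ Set.Ioo 0 Real.pi, (a : ℂ) ^ 2 * Complex.sin (θ : ℝ) ^ 2 *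
      (1 / (((a * Real.cos θ : ℝ) : ℂ) - e)) = ((-(a * Real.cos θ + e) : ℝ) : ℂ) := by
    intro θ hθ
    have hs := Real.sin_pos_of_mem_Ioo hθ
    have h1 : a * Real.cos θ - e ≠ 0 := by
      intro h
      have h2 : e = a * Real.cos θ := by linarith
      rw [h2] at he
      have h3 : a ^ 2 * Real.sin θ ^ 2 = 0 := by
        linear_combination a ^ 2 * Real.sin_sq_add_cos_sq θ - he
      exact absurd h3 (by positivity)
    have h2 : a ^ 2 * Real.sin θ ^ 2 * (1 / (a * Real.cos θ - e)) = -(a * Real.cos θ + e) := by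
      field_simp
      linear_combination a ^ 2 * Real.sin_sq_add_cos_sq θ - he
    rw [← h2]
    push_cast
    ring
  rw [intervalIntegral.integral_of_le Real.pi_pos.le, integral_Ioc_eq_integral_Ioo,
    setIntegral_congr_fun measurableSet_Ioo hcong, ← integral_Ioc_eq_integral_Ioo,
    ← intervalIntegral.integral_of_le Real.pi_pos.le, intervalIntegral.integral_ofReal,
    intervalIntegral.integral_neg, intervalIntegral.integral_add,
    intervalIntegral.integral_const_mul]
  · simp
  all_goals exact Continuous.intervalIntegrable (by fun_prop) _ _

/-! ### Zeros of the numerator on the cut and integrability -/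

/-- The roots of `N` on the cut are simple endpoints, so `N` splits off a product of distinct linear
factors there. -/
theorem exists_factor_cutInterval {c : ℝ} {N : ℂ[X]} {Z : Finset ℂ}
    (hZ : ∀ ζ, ζ ∈ Z ↔ ζ ∈ N.roots ∧ ζ ∉ cutInterval c)
    (hNI : ∀ t ∈ Set.Ioo (-(2 * √c)) (2 * √c), N.eval (t : ℂ) ≠ 0)
    (hr : N.rootMultiplicity ((2 * √c : ℝ) : ℂ) ≤ 1)
    (hl : N.rootMultiplicity ((-(2 * √c) : ℝ) : ℂ) ≤ 1) :
    ∃ E : Finset ℂ, E ⊆ {((2 * √c : ℝ) : ℂ), ((-(2 * √c) : ℝ) : ℂ)} ∧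
      (∀ ζ ∈ E, N.eval ζ = 0) ∧
      N = C N.leadingCoeff * ((∏ ζ ∈ E, (X - C ζ)) *
        ∏ ζ ∈ Z, (X - C ζ) ^ N.rootMultiplicity ζ) := by
  classical
  have hends : ∀ ζ ∈ N.roots, ζ ∈ cutInterval c →
      ζ = ((2 * √c : ℝ) : ℂ) ∨ ζ = ((-(2 * √c) : ℝ) : ℂ) := by
    rintro ζ hζ ⟨t, ht, rfl⟩
    have h0 := isRoot_of_mem_roots hζ
    by_contra! hne
    refine hNI t ⟨lt_of_le_of_ne ht.1 ?_, lt_of_le_of_ne ht.2 ?_⟩ h0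
    · rintro rfl; exact hne.2 rfl
    · rintro rfl; exact hne.1 rfl
  refine ⟨N.roots.toFinset.filter (· ∈ cutInterval c), fun ζ hζ => ?_, fun ζ hζ => ?_, ?_⟩
  · rw [Finset.mem_filter, Multiset.mem_toFinset] at hζ
    simpa using hends ζ hζ.1 hζ.2
  · rw [Finset.mem_filter, Multiset.mem_toFinset] at hζ
    exact isRoot_of_mem_roots hζ.1
  · have hZ' : Z = N.roots.toFinset.filter (¬ · ∈ cutInterval c) := by
      ext ζ; simp [hZ]
    conv_lhs => rw [(IsAlgClosed.splits N).eq_prod_roots, Finset.prod_multiset_map_count,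
      ← Finset.prod_filter_mul_prod_filter_not _ (· ∈ cutInterval c)]
    rw [hZ']
    congr 2
    · refine Finset.prod_congr rfl fun ζ hζ => ?_
      rw [Finset.mem_filter, Multiset.mem_toFinset] at hζ
      have h1 : 0 < N.roots.count ζ := Multiset.count_pos.2 hζ.1
      have h2 : N.roots.count ζ ≤ 1 := by
        rw [count_roots]
        rcases hends ζ hζ.1 hζ.2 with rfl | rfl
        exacts [hr, hl]
      rw [show N.roots.count ζ = 1 by omega, pow_one]
    · simp only [count_roots]

/-- A simple endpoint zero costs at most `1/√(a² - t²)`, which is integrable. The polynomial `K`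
supplies the endpoint factors missing from `N`, so that both endpoints are treated uniformly. -/
theorem integrableOn_semicircle_mul_div {c : ℝ} (hc : 0 < c) {N : ℂ[X]} (hN : N ≠ 0)
    (hNI : ∀ t ∈ Set.Ioo (-(2 * √c)) (2 * √c), N.eval (t : ℂ) ≠ 0)
    (hr : N.rootMultiplicity ((2 * √c : ℝ) : ℂ) ≤ 1)
    (hl : N.rootMultiplicity ((-(2 * √c) : ℝ) : ℂ) ≤ 1)
    {g : ℝ → ℂ} (hg : ContinuousOn g (Set.Icc (-(2 * √c)) (2 * √c))) :
    IntegrableOn (fun t : ℝ => (√(4 * c - t ^ 2) : ℂ) * (g t / N.eval (t : ℂ)))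
      (Set.Icc (-(2 * √c)) (2 * √c)) := by
  classical
  obtain ⟨E, hE, -, hfac⟩ := exists_factor_cutInterval
    (Z := N.roots.toFinset.filter (· ∉ cutInterval c)) (by simp) hNI hr hl
  set Z := N.roots.toFinset.filter (· ∉ cutInterval c) with hZdef
  have ha : 0 < 2 * √c := by positivity
  have hac := two_mul_sqrt_sq hc
  set a := 2 * √c
  set M : ℂ[X] := C N.leadingCoeff * ∏ ζ ∈ Z, (X - C ζ) ^ N.rootMultiplicity ζ with hM
  set K : ℂ[X] := ∏ ζ ∈ {((a : ℝ) : ℂ), ((-a : ℝ) : ℂ)} \ E, (X - C ζ) with hK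
  have hMI : ∀ t ∈ Set.Icc (-a) a, M.eval (t : ℂ) ≠ 0 := by
    intro t ht
    simp only [hM, eval_mul, eval_C, eval_prod, eval_pow, eval_sub, eval_X]
    refine mul_ne_zero (leadingCoeff_ne_zero.2 hN) (Finset.prod_ne_zero_iff.2 fun ζ hζ => ?_)
    refine pow_ne_zero _ (sub_ne_zero_of_notMem_cutInterval ?_ ht)
    exact (Finset.mem_filter.1 hζ).2
  have hEK : ∀ t : ℝ, (∏ ζ ∈ E, (X - C ζ)).eval (t : ℂ) * K.eval (t : ℂ) = (t : ℂ) ^ 2 - a ^ 2 := by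
    intro t
    have hne : ((a : ℝ) : ℂ) ≠ ((-a : ℝ) : ℂ) := by
      intro h
      have := Complex.ofReal_injective h
      linarith
    rw [hK, ← eval_mul, mul_comm, Finset.prod_sdiff hE, Finset.prod_pair hne]
    simp
    ring
  have hint : IntegrableOn (fun t : ℝ => ((1 / √(a ^ 2 - t ^ 2) : ℝ) : ℂ)) (Set.Icc (-a) a) :=
    (integrableOn_one_div_sqrt ha).ofReal
  have hcont : ContinuousOn (fun t : ℝ => -(g t * K.eval (t : ℂ) / M.eval (t : ℂ)))
      (Set.Icc (-a) a) := by
    refine ((hg.mul ?_).div ?_ hMI).neg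
    · exact (K.continuous.comp Complex.continuous_ofReal).continuousOn
    · exact (M.continuous.comp Complex.continuous_ofReal).continuousOn
  have hmul := IntegrableOn.mul_continuousOn hint hcont isCompact_Icc
  rw [integrableOn_Icc_iff_integrableOn_Ioo] at hmul ⊢
  refine hmul.congr_fun (fun t ht => ?_) measurableSet_Ioo
  have hpos : 0 < a ^ 2 - t ^ 2 := by nlinarith [ht.1, ht.2]
  have hN1 : N.eval (t : ℂ) = (∏ ζ ∈ E, (X - C ζ)).eval (t : ℂ) * M.eval (t : ℂ) := by
    conv_lhs => rw [hfac]
    rw [hM]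
    simp only [eval_mul]
    ring
  have h1 := hMI t (Set.Ioo_subset_Icc_self ht)
  have h2 : (∏ ζ ∈ E, (X - C ζ)).eval (t : ℂ) ≠ 0 := by
    intro h
    exact hNI t ht (by rw [hN1, h, zero_mul])
  have hs : ((√(a ^ 2 - t ^ 2) : ℝ) : ℂ) ^ 2 = (a : ℂ) ^ 2 - (t : ℂ) ^ 2 := by
    rw [← Complex.ofReal_pow, Real.sq_sqrt hpos.le]
    push_cast
    ring
  have hs0 : ((√(a ^ 2 - t ^ 2) : ℝ) : ℂ) ≠ 0 := by
    exact_mod_cast (Real.sqrt_pos.2 hpos).ne'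
  have hEKt := hEK t
  simp only [← hac, hN1]
  push_cast
  generalize ((√(a ^ 2 - t ^ 2) : ℝ) : ℂ) = s at *
  generalize eval (t : ℂ) (∏ ζ ∈ E, (X - C ζ)) = x at *
  have hsx : s ^ 2 = -(x * K.eval (t : ℂ)) := by rw [hs, hEKt]; ring
  field_simp
  linear_combination -g t * hsx

/-! ### Reduction to the semicircle by divided differences; partial fractions -/

/-- The divided difference of a pair of polynomials, as a polynomial in two variables. -/
theorem exists_evalEval_mul_sub_eq (D N : ℂ[X]) :
    ∃ B : ℂ[X][X], ∀ t w : ℂ,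
      (t - w) * B.evalEval t w = D.eval w * N.eval t - D.eval t * N.eval w := by
  have hroot : (X - C X : ℂ[X][X]) ∣ D.map C * C N - C D * N.map C := by
    rw [dvd_iff_isRoot, IsRoot.def]
    simp [eval_map]
  obtain ⟨B, hB⟩ := hroot
  refine ⟨-B, fun t w => ?_⟩
  have h := congrArg (evalEval t w) hB
  simp only [evalEval_sub, evalEval_mul, evalEval_map_C, evalEval_C, evalEval_X, eval_X] at h
  rw [evalEval_neg]
  linear_combination -h

theorem integrableOn_semicircle_mul_one_div_sub {c : ℝ} {w : ℂ} (hw : w ∉ cutInterval c) :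
    IntegrableOn (fun t : ℝ => (√(4 * c - t ^ 2) : ℂ) * (1 / ((t : ℂ) - w)))
      (Set.Icc (-(2 * √c)) (2 * √c)) := by
  refine ContinuousOn.integrableOn_compact isCompact_Icc (ContinuousOn.mul (by fun_prop) ?_)
  exact continuousOn_const.div (by fun_prop) fun t ht => sub_ne_zero_of_notMem_cutInterval hw ht

/-- The jump function `√(z² - 4c) D / N` differs from the Stieltjes transform of its boundary density
by a rational function with denominator `N`. -/
theorem exists_sqrtBranch_mul_div_eq {c : ℝ} (hc : 0 < c) {N : ℂ[X]} (hN : N ≠ 0) (D : ℂ[X])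
    (hNI : ∀ t ∈ Set.Ioo (-(2 * √c)) (2 * √c), N.eval (t : ℂ) ≠ 0)
    (hr : N.rootMultiplicity ((2 * √c : ℝ) : ℂ) ≤ 1)
    (hl : N.rootMultiplicity ((-(2 * √c) : ℝ) : ℂ) ≤ 1) :
    ∃ A : ℂ[X],
      (∀ w ∉ cutInterval c, N.eval w ≠ 0 → sqrtBranch c w * (D.eval w / N.eval w) =
        1 / Real.pi * (∫ t in Set.Icc (-(2 * √c)) (2 * √c), (√(4 * c - t ^ 2) : ℂ) *
          (D.eval (t : ℂ) / N.eval (t : ℂ) * (1 / ((t : ℂ) - w)))) + A.eval w / N.eval w) ∧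
      ∀ e : ℝ, e ^ 2 = 4 * c → N.eval (e : ℂ) = 0 → A.eval (e : ℂ) = 0 := by
  obtain ⟨B, hB⟩ := exists_evalEval_mul_sub_eq D N
  have hpi : (Real.pi : ℂ) ≠ 0 := by exact_mod_cast Real.pi_ne_zero
  set I := Set.Icc (-(2 * √c)) (2 * √c) with hI
  -- `A(w) = w D(w) + π⁻¹ ∫ √(4c - t²) B(t, w)/N(t) dt`, integrated coefficientwise in `w` to
  -- exhibit a polynomial.
  set A : ℂ[X] := X * D + C (1 / (Real.pi : ℂ)) * ∑ k ∈ Finset.range (B.natDegree + 1),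
    C (∫ t in I, (√(4 * c - t ^ 2) : ℂ) * ((B.coeff k).eval (t : ℂ) / N.eval (t : ℂ))) * X ^ k
    with hA
  have hBint : ∀ w : ℂ, IntegrableOn (fun t : ℝ => (√(4 * c - t ^ 2) : ℂ) *
      (B.evalEval (t : ℂ) w / N.eval (t : ℂ))) I := fun w => by
    refine integrableOn_semicircle_mul_div hc hN hNI hr hl (Continuous.continuousOn ?_)
    exact (B.eval (C w)).continuous.comp Complex.continuous_ofReal
  have hAeval : ∀ w : ℂ, A.eval w = w * D.eval w + 1 / Real.pi * ∫ t in I,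
      (√(4 * c - t ^ 2) : ℂ) * (B.evalEval (t : ℂ) w / N.eval (t : ℂ)) := by
    intro w
    have h1 : ∀ t : ℝ, (√(4 * c - t ^ 2) : ℂ) * (B.evalEval (t : ℂ) w / N.eval (t : ℂ)) =
        ∑ k ∈ Finset.range (B.natDegree + 1), (√(4 * c - t ^ 2) : ℂ) *
          ((B.coeff k).eval (t : ℂ) / N.eval (t : ℂ)) * w ^ k := by
      intro t
      rw [evalEval, eval_eq_sum_range (p := B), eval_finsetSum, Finset.sum_div, Finset.mul_sum]
      refine Finset.sum_congr rfl fun k _ => ?_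
      simp only [eval_mul, eval_pow, eval_C]
      ring
    simp_rw [h1]
    rw [integral_finsetSum]
    · simp only [hA, eval_add, eval_mul, eval_X, eval_C, eval_finsetSum, eval_pow,
        integral_mul_const]
    · intro k _
      refine Integrable.mul_const ?_ _
      refine integrableOn_semicircle_mul_div hc hN hNI hr hl (Continuous.continuousOn ?_)
      exact (B.coeff k).continuous.comp Complex.continuous_ofReal
  have hae : ∀ᵐ t ∂(volume.restrict I), t ∈ Set.Ioo (-(2 * √c)) (2 * √c) := by
    rw [hI, ← restrict_Ioo_eq_restrict_Icc]
    exact ae_restrict_mem measurableSet_Ioo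
  refine ⟨A, fun w hw hNw => ?_, fun e he hNe => ?_⟩
  · have hkey : N.eval w * (∫ t in I, (√(4 * c - t ^ 2) : ℂ) *
          (D.eval (t : ℂ) / N.eval (t : ℂ) * (1 / ((t : ℂ) - w)))) =
        D.eval w * (Real.pi * (sqrtBranch c w - w)) - ∫ t in I,
          (√(4 * c - t ^ 2) : ℂ) * (B.evalEval (t : ℂ) w / N.eval (t : ℂ)) := by
      rw [← integral_semicircle_div_sub hc hw, ← integral_const_mul, ← integral_const_mul,
        ← integral_sub ((integrableOn_semicircle_mul_one_div_sub hw).const_mul _) (hBint w)]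
      refine integral_congr_ae (hae.mono fun t ht => ?_)
      have h1 := hNI t ht
      have h2 := sub_ne_zero_of_notMem_cutInterval hw (Set.Ioo_subset_Icc_self ht)
      have h3 := hB t w
      simp only
      field_simp
      linear_combination (√(4 * c - t ^ 2) : ℂ) * h3
    rw [hAeval]
    generalize (∫ t in I, _ : ℂ) = x at hkey ⊢
    generalize (∫ t in I, _ : ℂ) = y at hkey ⊢
    field_simp
    linear_combination -hkey
  -- Since `N(e) = 0`, the integrand is `D(e) √(4c - t²)/(t - e)`; the integral cancels the term `e
  -- D(e)` of `A(e)`.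
  · have hint : ∫ t in I, (√(4 * c - t ^ 2) : ℂ) *
        (B.evalEval (t : ℂ) (e : ℂ) / N.eval (t : ℂ)) = D.eval (e : ℂ) * -(Real.pi * e) := by
      rw [← integral_semicircle_div_sub_endpoint hc he, ← integral_const_mul]
      refine integral_congr_ae (hae.mono fun t ht => ?_)
      have h1 := hNI t ht
      have h2 : (t : ℂ) - e ≠ 0 := by
        intro h
        rw [sub_eq_zero] at h
        exact h1 (h ▸ hNe)
      have h3 := hB t e
      rw [hNe] at h3
      simp only
      field_simp
      linear_combination (√(4 * c - t ^ 2) : ℂ) * h3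
    rw [hAeval, hint]
    field_simp
    ring

/-- The simple factors over `E` divide `A` and cancel; the division algorithm for the coprime powers
over `Z` does the rest. -/
theorem exists_eval_div_eq_add_sum {N A : ℂ[X]} (hN : N ≠ 0) {E Z : Finset ℂ} {m : ℂ → ℕ}
    (hA : ∀ ζ ∈ E, A.eval ζ = 0)
    (hfac : N = C N.leadingCoeff * ((∏ ζ ∈ E, (X - C ζ)) * ∏ ζ ∈ Z, (X - C ζ) ^ m ζ)) :
    ∃ (T : ℂ[X]) (r : ℂ → ℂ[X]), (∀ ζ ∈ Z, (r ζ).degree < m ζ) ∧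
      ∀ w, N.eval w ≠ 0 →
        A.eval w / N.eval w = T.eval w + ∑ ζ ∈ Z, (r ζ).eval w / (w - ζ) ^ m ζ := by
  classical
  have hcop : Pairwise (Function.onFun IsCoprime fun ζ : ℂ => (X - C ζ : ℂ[X])) :=
    pairwise_coprime_X_sub_C Function.injective_id
  obtain ⟨A', hA'⟩ : ∏ ζ ∈ E, (X - C ζ) ∣ A :=
    Finset.prod_dvd_of_coprime (hcop.set_pairwise _) fun ζ hζ => dvd_iff_isRoot.2 (hA ζ hζ)
  have hl : N.leadingCoeff ≠ 0 := leadingCoeff_ne_zero.2 hN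
  obtain ⟨T, r, hr, hT⟩ := eq_quo_mul_prod_add_sum_rem_mul_prod
    (C N.leadingCoeff⁻¹ * A') (s := Z) (g := fun ζ => (X - C ζ) ^ m ζ)
    (fun ζ _ => (monic_X_sub_C ζ).pow _) (fun x _ y _ hxy => (hcop hxy).pow)
  refine ⟨T, r, fun ζ hζ => by simpa using hr ζ hζ, fun w hw => ?_⟩
  have hNw : N.eval w = N.leadingCoeff *
      ((∏ ζ ∈ E, (X - C ζ)).eval w * ∏ ζ ∈ Z, (w - ζ) ^ m ζ) := by
    conv_lhs => rw [hfac]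
    simp [eval_prod]
  rw [hNw] at hw
  have hE0 := left_ne_zero_of_mul (right_ne_zero_of_mul hw)
  have hZ0 := right_ne_zero_of_mul (right_ne_zero_of_mul hw)
  have hAw : A.eval w / N.eval w = (C N.leadingCoeff⁻¹ * A').eval w / ∏ ζ ∈ Z, (w - ζ) ^ m ζ := by
    rw [hNw, hA', eval_mul, eval_mul, eval_C]
    field_simp
  rw [hAw, hT, eval_add, eval_mul, eval_finsetSum, add_div, Finset.sum_div]
  simp only [eval_mul, eval_prod, eval_pow, eval_sub, eval_X, eval_C]
  rw [mul_div_cancel_right₀ _ hZ0]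
  congr 1
  refine Finset.sum_congr rfl fun ζ hζ => ?_
  have h1 := Finset.prod_ne_zero_iff.1 hZ0 ζ hζ
  rw [← Finset.mul_prod_erase Z _ hζ] at hZ0 ⊢
  have h2 := right_ne_zero_of_mul hZ0
  field_simp

/-! ### The measure and its Stieltjes transform -/

theorem mem_zerosOff {c : ℝ} {Q : RatFunc ℂ} {ζ : ℂ} :
    ζ ∈ zerosOff c Q ↔ ζ ∈ Q.num.roots ∧ ζ ∉ cutInterval c := by
  simp [zerosOff]

theorem ratEval_eq (Q : RatFunc ℂ) (z : ℂ) : ratEval Q z = Q.num.eval z / Q.denom.eval z := by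
  simp [ratEval, RatFunc.eval, eval₂_id]

theorem measurable_semicircleOver_density (c : ℝ) (Q : RatFunc ℂ) :
    Measurable fun t : ℝ => √(4 * c - t ^ 2) / (ratEval Q (t : ℂ)).re := by
  simp only [ratEval_eq]
  have h1 : Measurable fun t : ℝ => Q.num.eval (t : ℂ) :=
    (Q.num.continuous.comp Complex.continuous_ofReal).measurable
  have h2 : Measurable fun t : ℝ => Q.denom.eval (t : ℂ) :=
    (Q.denom.continuous.comp Complex.continuous_ofReal).measurable
  have h3 : Measurable fun t : ℝ => √(4 * c - t ^ 2) := by fun_prop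
  exact h3.div (Complex.measurable_re.comp (h1.div h2))

theorem num_eval_ne_zero_of_pos {Q : RatFunc ℂ} {z : ℂ} (h : 0 < ratEval Q z) :
    Q.num.eval z ≠ 0 := by
  intro h0
  rw [ratEval_eq, h0, zero_div] at h
  exact lt_irrefl _ h

theorem ofReal_density_eq {c : ℝ} {Q : RatFunc ℂ} {t : ℝ} (h : 0 < ratEval Q (t : ℂ)) :
    ((√(4 * c - t ^ 2) / (ratEval Q (t : ℂ)).re : ℝ) : ℂ) =
      (√(4 * c - t ^ 2) : ℂ) * (Q.denom.eval (t : ℂ) / Q.num.eval (t : ℂ)) := by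
  -- Positivity in the order on `ℂ` includes being real.
  have him : ((ratEval Q (t : ℂ)).re : ℂ) = ratEval Q (t : ℂ) :=
    Complex.ext (by simp) (by simpa using (Complex.lt_def.1 h).2)
  rw [Complex.ofReal_div, him, ratEval_eq, div_div_eq_mul_div, mul_div_assoc]

theorem ae_restrict_Icc_mem_Ioo (a b : ℝ) :
    ∀ᵐ t ∂(volume.restrict (Set.Icc a b)), t ∈ Set.Ioo a b := by
  rw [← restrict_Ioo_eq_restrict_Icc]
  exact ae_restrict_mem measurableSet_Ioo

theorem isFiniteMeasure_semicircleOver {c : ℝ} (hc : 0 < c) {Q : RatFunc ℂ}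
    (hpos : ∀ t ∈ Set.Ioo (-(2 * √c)) (2 * √c), 0 < ratEval Q (t : ℂ)) (hQ : Q.num ≠ 0)
    (hr : zeroMult Q ((2 * √c : ℝ) : ℂ) ≤ 1) (hl : zeroMult Q ((-(2 * √c) : ℝ) : ℂ) ≤ 1) :
    IsFiniteMeasure (semicircleOver c Q) := by
  have hint := integrableOn_semicircle_mul_div hc hQ
    (fun t ht => num_eval_ne_zero_of_pos (hpos t ht)) hr hl
    (g := fun t => Q.denom.eval (t : ℂ))
    (Q.denom.continuous.comp Complex.continuous_ofReal).continuousOn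
  have hint' : Integrable (fun t : ℝ => √(4 * c - t ^ 2) / (ratEval Q (t : ℂ)).re)
      (volume.restrict (Set.Icc (-(2 * √c)) (2 * √c))) := by
    refine Integrable.congr hint.re ((ae_restrict_Icc_mem_Ioo _ _).mono fun t ht => ?_)
    have h := ofReal_density_eq (c := c) (hpos t ht)
    simp only [← h]
    exact Complex.ofReal_re _
  exact isFiniteMeasure_withDensity_ofReal hint'.2

theorem stieltjesTransform_semicircleOver {c : ℝ} {Q : RatFunc ℂ}
    (hpos : ∀ t ∈ Set.Ioo (-(2 * √c)) (2 * √c), 0 < ratEval Q (t : ℂ)) (w : ℂ) :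
    stieltjesTransform (semicircleOver c Q) w =
      ∫ t in Set.Icc (-(2 * √c)) (2 * √c), (√(4 * c - t ^ 2) : ℂ) *
        (Q.denom.eval (t : ℂ) / Q.num.eval (t : ℂ) * (1 / ((t : ℂ) - w))) := by
  rw [stieltjesTransform_eq, semicircleOver, integral_withDensity_eq_integral_toReal_smul
    (measurable_semicircleOver_density c Q).ennreal_ofReal (by simp)]
  refine integral_congr_ae ((ae_restrict_Icc_mem_Ioo _ _).mono fun t ht => ?_)
  have h := hpos t ht
  have hnn : 0 ≤ √(4 * c - t ^ 2) / (ratEval Q (t : ℂ)).re :=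
    div_nonneg (Real.sqrt_nonneg _) (Complex.lt_def.1 h).1.le
  simp only [ENNReal.toReal_ofReal hnn, Complex.real_smul, ofReal_density_eq h, mul_assoc]

theorem mem_ae_semicircleOver (c : ℝ) (Q : RatFunc ℂ) :
    ∀ᵐ t ∂(semicircleOver c Q), t ∈ Set.Icc (-(2 * √c)) (2 * √c) :=
  (withDensity_absolutelyContinuous _ _).ae_le (ae_restrict_mem measurableSet_Icc)

theorem differentiableAt_stieltjesTransform {c : ℝ} {Q : RatFunc ℂ}
    [IsFiniteMeasure (semicircleOver c Q)] {w : ℂ} (hw : w ∉ cutInterval c) :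
    DifferentiableAt ℂ (stieltjesTransform (semicircleOver c Q)) w := by
  refine (hasDerivAt_resolventTransform w fun h => hw ?_).differentiableAt
  obtain ⟨t, ht, rfl⟩ := h
  exact ⟨t, Measure.support_subset_of_isClosed isClosed_Icc (mem_ae_semicircleOver c Q) ht, rfl⟩

theorem tendsto_stieltjesTransform_cobounded {c : ℝ} {Q : RatFunc ℂ}
    [IsFiniteMeasure (semicircleOver c Q)] :
    Tendsto (stieltjesTransform (semicircleOver c Q)) (Bornology.cobounded ℂ) (nhds 0) := by
  have hlim : Tendsto (fun z : ℂ => (semicircleOver c Q).real Set.univ * (‖z‖ - 2 * √c)⁻¹)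
      (Bornology.cobounded ℂ) (nhds 0) := by
    have h1 : Tendsto (fun z : ℂ => ‖z‖ - 2 * √c) (Bornology.cobounded ℂ) atTop :=
      tendsto_atTop_add_const_right _ _ tendsto_norm_cobounded_atTop
    simpa using (tendsto_inv_atTop_zero.comp h1).const_mul ((semicircleOver c Q).real Set.univ)
  refine squeeze_zero_norm' ?_ hlim
  filter_upwards [tendsto_norm_cobounded_atTop.eventually_gt_atTop (2 * √c)] with z hz
  rw [stieltjesTransform_eq, mul_comm]
  refine norm_integral_le_of_norm_le_const ((mem_ae_semicircleOver c Q).mono fun t ht => ?_)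
  rw [one_div, norm_inv]
  refine inv_anti₀ (by linarith) ?_
  have h1 : ‖(t : ℂ)‖ ≤ 2 * √c := by
    rw [Complex.norm_real]; exact abs_le.2 ht
  have h2 := norm_sub_norm_le z (t : ℂ)
  rw [norm_sub_rev] at h2
  linarith

/-- Decomposition of `√(z² - 4c) / Q` into its Stieltjes transform, polynomial part and principal
parts. -/
theorem exists_sqrtBranch_div_eq {c : ℝ} (hc : 0 < c) {Q : RatFunc ℂ}
    (hpos : ∀ t ∈ Set.Ioo (-(2 * √c)) (2 * √c), 0 < ratEval Q (t : ℂ)) (hQ : Q.num ≠ 0)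
    (hr : zeroMult Q ((2 * √c : ℝ) : ℂ) ≤ 1) (hl : zeroMult Q ((-(2 * √c) : ℝ) : ℂ) ≤ 1) :
    ∃ (T : ℂ[X]) (r : ℂ → ℂ[X]), (∀ ζ ∈ zerosOff c Q, (r ζ).degree < zeroMult Q ζ) ∧
      ∀ w ∉ cutInterval c, Q.num.eval w ≠ 0 →
        sqrtBranch c w * (Q.denom.eval w / Q.num.eval w) =
          1 / Real.pi * stieltjesTransform (semicircleOver c Q) w + (T.eval w +
            ∑ ζ ∈ zerosOff c Q, (r ζ).eval w / (w - ζ) ^ zeroMult Q ζ) := by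
  have hNI := fun t ht => num_eval_ne_zero_of_pos (hpos t ht)
  obtain ⟨A, hA, hAend⟩ := exists_sqrtBranch_mul_div_eq hc hQ Q.denom hNI hr hl
  obtain ⟨E, hE, hE0, hfac⟩ := exists_factor_cutInterval (fun ζ => mem_zerosOff (c := c)) hNI hr hl
  have hac := two_mul_sqrt_sq hc
  obtain ⟨T, r, hdeg, hT⟩ := exists_eval_div_eq_add_sum hQ (A := A) (E := E) (fun ζ hζ => by
    have h0 := hE0 ζ hζ
    have h1 := hE hζ
    simp only [Finset.mem_insert, Finset.mem_singleton] at h1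
    rcases h1 with rfl | rfl
    · exact hAend _ hac h0
    · exact hAend _ (by rw [neg_sq, hac]) h0) hfac
  refine ⟨T, r, hdeg, fun w hw hNw => ?_⟩
  rw [hA w hw hNw, stieltjesTransform_semicircleOver hpos, hT w hNw]
  rfl

/-! ### Higher derivatives at a zero of `Q` -/

theorem iteratedDeriv_sub_pow_mul_eq_zero {h : ℂ → ℂ} {ζ : ℂ} (hh : AnalyticAt ℂ h ζ) {k m : ℕ}
    (hk : k < m) : iteratedDeriv k (fun z => (z - ζ) ^ m * h z) ζ = 0 := by
  have han : AnalyticAt ℂ (fun z => (z - ζ) ^ m * h z) ζ := by fun_prop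
  refine (natCast_le_analyticOrderAt_iff_iteratedDeriv_eq_zero han).1 ?_ k hk
  exact (natCast_le_analyticOrderAt han).2 ⟨h, hh, by simp⟩

theorem iteratedDeriv_polynomial_eval (p : ℂ[X]) (k : ℕ) :
    iteratedDeriv k (fun z => p.eval z) = fun z => (derivative^[k] p).eval z := by
  induction k generalizing p with
  | zero => simp
  | succ k ih =>
    have hd : deriv (fun z => p.eval z) = fun z => (derivative p).eval z := by
      ext z; exact p.deriv
    rw [iteratedDeriv_succ', hd, ih, Function.iterate_succ_apply]

theorem iteratedDeriv_one_div_sub (k : ℕ) (w ζ : ℂ) :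
    iteratedDeriv k (fun z => 1 / (z - w)) ζ = (-1) ^ k * k.factorial / (ζ - w) ^ (k + 1) := by
  have h := iteratedDeriv_comp_sub_const (f := (Inv.inv : ℂ → ℂ)) k w
  simp only [one_div]
  have h2 := congrFun h ζ
  refine h2.trans ?_
  rw [iteratedDeriv_eq_iterate, iter_deriv_inv, div_eq_mul_inv,
    ← zpow_natCast (ζ - w), ← zpow_neg]
  congr 2
  push_cast
  ring

/-- Divide: `r(z)/(z - w) = p(z) + r(w)/(z - w)` with `deg p < m - 1`, so `p` dies under `m - 1`
derivatives. -/
theorem iteratedDeriv_eval_div_sub {r : ℂ[X]} {m : ℕ} (hm : 0 < m) (hr : r.degree < m) {w ζ : ℂ}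
    (hw : w ≠ ζ) : iteratedDeriv (m - 1) (fun z => r.eval z / (z - w)) ζ =
      -((m - 1).factorial * (r.eval w / (w - ζ) ^ m)) := by
  obtain ⟨k, rfl⟩ : ∃ k, m = k + 1 := ⟨m - 1, by omega⟩
  rw [Nat.add_sub_cancel]
  have hζw : ζ - w ≠ 0 := sub_ne_zero.2 hw.symm
  set p := r /ₘ (X - C w) with hp
  have hrp : ∀ z, r.eval z = (z - w) * p.eval z + r.eval w := by
    intro z
    conv_lhs => rw [← modByMonic_add_div r (X - C w), modByMonic_X_sub_C_eq_C_eval]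
    simp [hp]
    ring
  have hev : (fun z => r.eval z / (z - w)) =ᶠ[nhds ζ]
      fun z => p.eval z + r.eval w * (1 / (z - w)) := by
    filter_upwards [(continuous_id.sub continuous_const).continuousAt.eventually_ne hζw] with z hz
    have hz' : z - w ≠ 0 := hz
    rw [hrp z]
    field_simp
  have hpk : derivative^[k] p = 0 := by
    apply iterate_derivative_eq_zero_of_degree_lt
    by_cases hr0 : r = 0
    · rw [hp, hr0, zero_divByMonic, degree_zero]; exact WithBot.bot_lt_coe _
    · have h1 : p.degree < r.degree := degree_divByMonic_lt r _ hr0 (by simp)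
      by_cases hp0 : p = 0
      · rw [hp0, degree_zero]; exact WithBot.bot_lt_coe _
      · rw [degree_eq_natDegree hp0, degree_eq_natDegree hr0] at h1
        rw [degree_eq_natDegree hr0] at hr
        rw [degree_eq_natDegree hp0]
        norm_cast at h1 hr ⊢
        omega
  have han : ContDiffAt ℂ k (fun z => r.eval w * (1 / (z - w))) ζ :=
    contDiffAt_const.mul (contDiffAt_const.div (by fun_prop) hζw)
  rw [hev.iteratedDeriv_eq, iteratedDeriv_fun_add p.differentiable.contDiff.contDiffAt han,
    iteratedDeriv_polynomial_eval, hpk, iteratedDeriv_const_mul_field, iteratedDeriv_one_div_sub,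
    ← neg_sub ζ w, neg_pow (ζ - w)]
  have h1 : ((-1 : ℂ)) ^ k * (-1) ^ k = 1 := by rw [← mul_pow]; simp
  have h2 : ((-1 : ℂ)) ^ k ≠ 0 := by simp
  rw [pow_succ (-1 : ℂ) k]
  simp only [eval_zero]
  field_simp
  linear_combination r.eval w * k.factorial * h1

/-! ### Decay at infinity and large circles -/

theorem tendsto_eval_div_sub_pow_cobounded {r : ℂ[X]} {m : ℕ} (hr : r.degree < m) (ζ : ℂ) :
    Tendsto (fun z => r.eval z / (z - ζ) ^ m) (Bornology.cobounded ℂ) (nhds 0) := by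
  have h : r.eval =o[Bornology.cobounded ℂ] ((X - C ζ) ^ m).eval :=
    isLittleO_cobounded_of_degree_lt (by simpa using hr)
  simpa using h.tendsto_div_nhds_zero

/-- A function holomorphic near infinity that is `o(1 / z)` has vanishing integral over large
circles. -/
theorem circleIntegral_eq_zero_of_tendsto_cobounded {g : ℂ → ℂ} {R₀ R : ℝ} (hR₀ : 0 ≤ R₀)
    (hd : ∀ z, R₀ < ‖z‖ → DifferentiableAt ℂ g z)
    (hlim : Tendsto (fun z => z * g z) (Bornology.cobounded ℂ) (nhds 0)) (hR : R₀ < R) :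
    ∮ z in C(0, R), g z = 0 := by
  have hRpos : 0 < R := hR₀.trans_lt hR
  have hle : ∀ ε : ℝ, 0 < ε → ‖∮ z in C(0, R), g z‖ ≤ 2 * Real.pi * ε := by
    intro ε hε
    have hev : ∀ᶠ z in Bornology.cobounded ℂ, ‖z * g z‖ < ε := by
      simpa using hlim.norm.eventually_lt_const (by simpa using hε)
    obtain ⟨R₁, -, hR₁⟩ := (hasBasis_cobounded_norm (E := ℂ)).eventually_iff.1 hev
    -- The integral is the same over the larger circle of radius `R₂`, where `|g| ≤ ε/R₂`.
    set R₂ := max R R₁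
    have hR₂ : 0 < R₂ := hRpos.trans_le (le_max_left _ _)
    rw [← Complex.circleIntegral_eq_of_differentiable_on_annulus_off_countable hRpos
      (le_max_left R R₁) Set.countable_empty (f := g)]
    · refine (circleIntegral.norm_integral_le_of_norm_le_const (C := ε / R₂) hR₂.le ?_).trans_eq ?_
      · intro z hz
        have hz' : ‖z‖ = R₂ := by simpa using hz
        have h := hR₁ (x := z) (by
          show R₁ ≤ ‖z‖
          rw [hz']; exact le_max_right _ _)
        rw [norm_mul, hz'] at h
        rw [le_div_iff₀ hR₂]
        linarith
      · field_simp
    · intro z hz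
      refine (hd z (hR.trans_le ?_)).continuousAt.continuousWithinAt
      simpa using hz.2
    · intro z hz
      refine hd z (hR.trans_le ?_)
      have := hz.1.2
      simp only [Metric.mem_closedBall, dist_zero_right, not_le] at this
      exact this.le
  have h0 : ‖∮ z in C(0, R), g z‖ ≤ 0 := by
    refine le_of_forall_pos_le_add fun ε hε => ?_
    have h := hle (ε / (2 * Real.pi)) (by positivity)
    rw [mul_div_cancel₀ _ (by positivity)] at h
    linarith
  exact norm_le_zero_iff.1 h0

/-! ### Identifying the principal parts and the polynomial part -/

theorem ratEval_div {p q : ℂ[X]} {z : ℂ} (hq : q.eval z ≠ 0) :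
    ratEval (algebraMap ℂ[X] (RatFunc ℂ) p / algebraMap ℂ[X] (RatFunc ℂ) q) z =
      p.eval z / q.eval z := by
  have hq0 : q ≠ 0 := by rintro rfl; simp at hq
  set x := algebraMap ℂ[X] (RatFunc ℂ) p / algebraMap ℂ[X] (RatFunc ℂ) q with hx
  have h := (RatFunc.num_mul_eq_mul_denom_iff (x := x) (p := p) hq0).2 hx
  obtain ⟨s, hs⟩ := RatFunc.denom_div_dvd p q
  have hd : x.denom.eval z ≠ 0 := by
    intro h0
    apply hq
    rw [hs, eval_mul, h0, zero_mul]
  have h' := congrArg (eval z) h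
  rw [eval_mul, eval_mul] at h'
  rw [ratEval_eq, div_eq_div_iff hd hq, h']

/-- After multiplication by `(z - ζ)^m/(z - w)`, every term of the decomposition but the one at `ζ`
vanishes to order `m` there. -/
theorem iteratedDeriv_sqrtBranch_mul_ratEval {c : ℝ} (hc : 0 < c) {Q : RatFunc ℂ} (hQ : Q.num ≠ 0)
    {S : ℂ → ℂ} (hS : ∀ w ∉ cutInterval c, DifferentiableAt ℂ S w) {T : ℂ[X]} {r : ℂ → ℂ[X]}
    (hdeg : ∀ ζ ∈ zerosOff c Q, (r ζ).degree < zeroMult Q ζ)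
    (hF : ∀ w ∉ cutInterval c, Q.num.eval w ≠ 0 →
        sqrtBranch c w * (Q.denom.eval w / Q.num.eval w) =
          S w + (T.eval w + ∑ ζ ∈ zerosOff c Q, (r ζ).eval w / (w - ζ) ^ zeroMult Q ζ))
    {ζ : ℂ} (hζ : ζ ∈ zerosOff c Q) {w : ℂ} (hw : w ≠ ζ) :
    iteratedDeriv (zeroMult Q ζ - 1) (fun z : ℂ => sqrtBranch c z / (z - w) *
        ratEval ((RatFunc.X - RatFunc.C ζ) ^ zeroMult Q ζ / Q) z) ζ =
      -((zeroMult Q ζ - 1).factorial * ((r ζ).eval w / (w - ζ) ^ zeroMult Q ζ)) := by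
  classical
  obtain ⟨hroot, hcut⟩ := mem_zerosOff.1 hζ
  have hm : 0 < zeroMult Q ζ := (rootMultiplicity_pos hQ).2 (isRoot_of_mem_roots hroot)
  have hζw : ζ - w ≠ 0 := sub_ne_zero.2 hw.symm
  obtain ⟨N, hN, hNζ⟩ := exists_eq_pow_rootMultiplicity_mul_and_not_dvd Q.num hQ ζ
  replace hN : Q.num = (X - C ζ) ^ zeroMult Q ζ * N := hN
  rw [dvd_iff_isRoot] at hNζ
  replace hNζ : N.eval ζ ≠ 0 := hNζ
  set m := zeroMult Q ζ
  have hrat : (RatFunc.X - RatFunc.C ζ) ^ m / Q =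
      algebraMap ℂ[X] (RatFunc ℂ) Q.denom / algebraMap ℂ[X] (RatFunc ℂ) N := by
    have hN0 : N ≠ 0 := by rintro rfl; simp at hNζ
    have hXC : (RatFunc.X - RatFunc.C ζ : RatFunc ℂ) = algebraMap ℂ[X] (RatFunc ℂ) (X - C ζ) := by
      simp
    have h1 := RatFunc.algebraMap_ne_zero hN0
    have h2 := RatFunc.algebraMap_ne_zero Q.denom_ne_zero
    have h3 := RatFunc.algebraMap_ne_zero (X_sub_C_ne_zero ζ)
    conv_lhs => rw [← RatFunc.num_div_denom Q, hN]
    rw [hXC, map_mul, map_pow]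
    field_simp
  set h : ℂ → ℂ := fun z => (S z + (T.eval z +
    ∑ ξ ∈ (zerosOff c Q).erase ζ, (r ξ).eval z / (z - ξ) ^ zeroMult Q ξ)) / (z - w) with hh
  have hSan : AnalyticAt ℂ S ζ := by
    rw [Complex.analyticAt_iff_eventually_differentiableAt]
    filter_upwards [(isClosed_cutInterval c).isOpen_compl.mem_nhds hcut] with z hz using hS z hz
  have hpoly : ∀ p : ℂ[X], AnalyticAt ℂ (fun z => p.eval z) ζ := fun p =>
    p.differentiable.analyticAt ζ
  have hhan : AnalyticAt ℂ h ζ := by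
    refine (hSan.add ((hpoly T).add ?_)).div (by fun_prop) hζw
    refine Finset.analyticAt_fun_sum _ fun ξ hξ => (hpoly _).div (by fun_prop) ?_
    exact pow_ne_zero _ (sub_ne_zero.2 (Finset.ne_of_mem_erase hξ).symm)
  have hran : AnalyticAt ℂ (fun z => (r ζ).eval z / (z - w)) ζ :=
    (hpoly _).div (by fun_prop) hζw
  have hpan : AnalyticAt ℂ (fun z => (z - ζ) ^ m * h z) ζ := by fun_prop
  have hNev : ∀ᶠ z in nhds ζ, N.eval z ≠ 0 := N.continuous.continuousAt.eventually_ne hNζ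
  have hev1 : (fun z : ℂ => sqrtBranch c z / (z - w) *
      ratEval ((RatFunc.X - RatFunc.C ζ) ^ m / Q) z) =ᶠ[nhds ζ]
      fun z => sqrtBranch c z / (z - w) * (Q.denom.eval z / N.eval z) := by
    filter_upwards [hNev] with z hz
    rw [hrat, ratEval_div hz]
  have hev2 : (fun z => sqrtBranch c z / (z - w) * (Q.denom.eval z / N.eval z)) =ᶠ[nhds ζ]
      fun z => (z - ζ) ^ m * h z + (r ζ).eval z / (z - w) := by
    -- The decomposition is available only for `z ≠ ζ`; continuity of both sides extends the
    -- equality to `ζ`.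
    rw [← ContinuousAt.eventuallyEq_nhds_iff_eventuallyEq_nhdsNE]
    · filter_upwards [nhdsWithin_le_nhds hNev, self_mem_nhdsWithin, nhdsWithin_le_nhds
        ((isClosed_cutInterval c).isOpen_compl.mem_nhds hcut)] with z hz hzζ hzc
      have hzζ' : z - ζ ≠ 0 := sub_ne_zero.2 hzζ
      have hpow := pow_ne_zero m hzζ'
      have hNz : Q.num.eval z = (z - ζ) ^ m * N.eval z := by
        conv_lhs => rw [hN]
        simp
      have hFz := hF z hzc (by rw [hNz]; exact mul_ne_zero hpow hz)
      rw [← Finset.add_sum_erase _ _ hζ, hNz] at hFz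
      have hmain : sqrtBranch c z * (Q.denom.eval z / N.eval z) = (z - ζ) ^ m * (S z + (T.eval z +
          ∑ ξ ∈ (zerosOff c Q).erase ζ, (r ξ).eval z / (z - ξ) ^ zeroMult Q ξ)) +
          (r ζ).eval z := by
        generalize ∑ ξ ∈ (zerosOff c Q).erase ζ, (r ξ).eval z / (z - ξ) ^ zeroMult Q ξ = x at hFz ⊢
        have h1 : (z - ζ) ^ m * (sqrtBranch c z * (Q.denom.eval z / ((z - ζ) ^ m * N.eval z))) =
            sqrtBranch c z * (Q.denom.eval z / N.eval z) := by
          field_simp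
        have h2 : (z - ζ) ^ m * ((r ζ).eval z / (z - ζ) ^ m) = (r ζ).eval z :=
          mul_div_cancel₀ _ hpow
        rw [← h1, hFz]
        linear_combination h2
      rw [div_mul_eq_mul_div, hmain, hh]
      ring
    · refine ((continuousAt_sqrtBranch hc hcut).div (by fun_prop) hζw).mul ?_
      exact Q.denom.continuous.continuousAt.div N.continuous.continuousAt hNζ
    · exact (hpan.add hran).continuousAt
  rw [(hev1.trans hev2).iteratedDeriv_eq, iteratedDeriv_fun_add hpan.contDiffAt hran.contDiffAt,
    iteratedDeriv_sub_pow_mul_eq_zero hhan (Nat.sub_lt hm one_pos), zero_add,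
    iteratedDeriv_eval_div_sub hm (hdeg ζ hζ) hw]

/-- Apart from `T`, the decomposition tends to `0` at infinity, so divided by `z - w` it is `o(1/z)`
and integrates to `0`; Cauchy's formula evaluates the `T` term. -/
theorem eventually_eval_eq_circleIntegral {c : ℝ} {Q : RatFunc ℂ} (hQ : Q.num ≠ 0)
    {S : ℂ → ℂ} (hS : ∀ w ∉ cutInterval c, DifferentiableAt ℂ S w)
    (hSlim : Tendsto S (Bornology.cobounded ℂ) (nhds 0)) {T : ℂ[X]} {r : ℂ → ℂ[X]}
    (hdeg : ∀ ζ ∈ zerosOff c Q, (r ζ).degree < zeroMult Q ζ)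
    (hF : ∀ w ∉ cutInterval c, Q.num.eval w ≠ 0 →
        sqrtBranch c w * (Q.denom.eval w / Q.num.eval w) =
          S w + (T.eval w + ∑ ζ ∈ zerosOff c Q, (r ζ).eval w / (w - ζ) ^ zeroMult Q ζ))
    (w : ℂ) :
    ∀ᶠ R : ℝ in atTop, T.eval w = 1 / (2 * (Real.pi : ℂ) * Complex.I) *
      ∮ z in C(0, R), 1 / (z - w) * (sqrtBranch c z / ratEval Q z) := by
  have hbdd : Bornology.IsBounded (cutInterval c ∪ ({z | z ∈ Q.num.roots} ∪ {w})) := by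
    refine (isCompact_Icc.image Complex.continuous_ofReal).isBounded.union
      (Bornology.IsBounded.union (Set.Finite.isBounded ?_) Bornology.isBounded_singleton)
    exact Multiset.finite_toSet _
  obtain ⟨R₀, hR₀pos, hR₀⟩ := hbdd.exists_pos_norm_le
  have hout : ∀ z : ℂ, R₀ < ‖z‖ → z ∉ cutInterval c ∧ Q.num.eval z ≠ 0 ∧ z - w ≠ 0 := by
    intro z hz
    have h : z ∉ cutInterval c ∪ ({z | z ∈ Q.num.roots} ∪ {w}) :=
      fun h => (hR₀ z h).not_gt hz
    simp only [Set.mem_union, not_or, Set.mem_singleton_iff] at h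
    refine ⟨h.1, fun h0 => h.2.1 ((mem_roots hQ).2 h0), sub_ne_zero.2 h.2.2⟩
  have hwR₀ : ‖w‖ ≤ R₀ := hR₀ w (by simp)
  set G : ℂ → ℂ := fun z =>
    S z + ∑ ζ ∈ zerosOff c Q, (r ζ).eval z / (z - ζ) ^ zeroMult Q ζ with hG
  have hGd : ∀ z, R₀ < ‖z‖ → DifferentiableAt ℂ G z := by
    intro z hz
    obtain ⟨h1, h2, -⟩ := hout z hz
    refine (hS z h1).add (DifferentiableAt.fun_sum fun ζ hζ => ?_)
    refine (r ζ).differentiable.differentiableAt.div (by fun_prop) (pow_ne_zero _ ?_)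
    rw [sub_ne_zero]
    rintro rfl
    exact h2 (isRoot_of_mem_roots (mem_zerosOff.1 hζ).1)
  have hGlim : Tendsto G (Bornology.cobounded ℂ) (nhds 0) := by
    have h := hSlim.add (tendsto_finsetSum (zerosOff c Q) fun ζ hζ =>
      tendsto_eval_div_sub_pow_cobounded (hdeg ζ hζ) ζ)
    simpa using h
  have hgd : ∀ z, R₀ < ‖z‖ → DifferentiableAt ℂ (fun z => G z / (z - w)) z := fun z hz =>
    (hGd z hz).div (by fun_prop) (hout z hz).2.2
  have hglim : Tendsto (fun z => z * (G z / (z - w))) (Bornology.cobounded ℂ) (nhds 0) := by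
    have hinv : Tendsto (fun z : ℂ => (z - w)⁻¹) (Bornology.cobounded ℂ) (nhds 0) :=
      tendsto_inv₀_cobounded.comp (tendsto_sub_const_cobounded w)
    have h : Tendsto (fun z => G z * (1 + w * (z - w)⁻¹)) (Bornology.cobounded ℂ) (nhds 0) := by
      simpa using hGlim.mul ((hinv.const_mul w).const_add 1)
    refine h.congr' ?_
    filter_upwards [tendsto_norm_cobounded_atTop.eventually_gt_atTop R₀] with z hz
    have := (hout z hz).2.2
    field_simp
    ring
  filter_upwards [eventually_gt_atTop R₀] with R hR
  have hRpos : 0 < R := hR₀pos.trans hR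
  have hz0 := circleIntegral_eq_zero_of_tendsto_cobounded hR₀pos.le hgd hglim hR
  have hsph : ∀ z ∈ Metric.sphere (0 : ℂ) R, R₀ < ‖z‖ := fun z hz => by
    rw [mem_sphere_zero_iff_norm] at hz; rwa [hz]
  have hcong : Set.EqOn (fun z => 1 / (z - w) * (sqrtBranch c z / ratEval Q z))
      (fun z => (z - w)⁻¹ • T.eval z + G z / (z - w)) (Metric.sphere 0 R) := by
    intro z hz
    obtain ⟨h1, h2, h3⟩ := hout z (hsph z hz)
    have h := hF z h1 h2
    simp only
    rw [ratEval_eq, div_div_eq_mul_div, mul_div_assoc, h, hG, smul_eq_mul]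
    ring
  rw [circleIntegral.integral_congr hRpos.le hcong, circleIntegral.integral_add, hz0,
    T.differentiable.differentiableOn.circleIntegral_sub_inv_smul
      (by simpa using hwR₀.trans_lt hR)]
  · have hpi : (Real.pi : ℂ) ≠ 0 := by exact_mod_cast Real.pi_ne_zero
    have hI := Complex.I_ne_zero
    rw [smul_eq_mul, add_zero]
    field_simp
  · refine ContinuousOn.circleIntegrable hRpos.le fun z hz => ContinuousAt.continuousWithinAt ?_
    have hinv : ContinuousAt (fun z => (z - w)⁻¹) z :=
      ContinuousAt.inv₀ (by fun_prop) (hout z (hsph z hz)).2.2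
    exact hinv.smul T.continuous.continuousAt
  · exact ContinuousOn.circleIntegrable hRpos.le fun z hz =>
      (hgd z (hsph z hz)).continuousAt.continuousWithinAt

/-! ### The main theorem -/

theorem mainTheorem4 (c : ℝ) (hc : 0 < c) (Q : RatFunc ℂ)
    (hpos : ∀ t : ℝ, -(2 * √c) < t → t < 2 * √c → 0 < ratEval Q (t : ℂ))
    (hpole_right : zeroMult Q ((2 * √c : ℝ) : ℂ) ≤ 1)
    (hpole_left : zeroMult Q ((-(2 * √c) : ℝ) : ℂ) ≤ 1) :
    IsFiniteMeasure (semicircleOver c Q) ∧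
    ∃ (q : ℂ → ℂ[X]) (RQ : ℂ[X]),
      (∀ ζ ∈ zerosOff c Q,
        (q ζ).natDegree ≤ zeroMult Q ζ - 1 ∧
        ∀ w : ℂ, w ≠ ζ →
          iteratedDeriv (zeroMult Q ζ - 1)
            (fun z : ℂ => sqrtBranch c z / (z - w) *
              ratEval ((RatFunc.X - RatFunc.C ζ) ^ zeroMult Q ζ / Q) z) ζ
          = ((zeroMult Q ζ - 1).factorial : ℂ) *
              ((q ζ).eval w / (ζ - w) ^ zeroMult Q ζ)) ∧
      (∀ w : ℂ, ∀ᶠ R : ℝ in atTop,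
        RQ.eval w = 1 / (2 * (Real.pi : ℂ) * Complex.I) *
          ∮ z in C(0, R), 1 / (z - w) * (sqrtBranch c z / ratEval Q z)) ∧
      ∀ w : ℂ, w.im ≠ 0 → Q.num.eval w ≠ 0 →
        stieltjesTransform (semicircleOver c Q) w
          = (Real.pi : ℂ) * (sqrtBranch c w / ratEval Q w)
            + (Real.pi : ℂ) * ∑ ζ ∈ zerosOff c Q, (q ζ).eval w / (ζ - w) ^ zeroMult Q ζ
            - (Real.pi : ℂ) * RQ.eval w := by
  have hpos' : ∀ t ∈ Set.Ioo (-(2 * √c)) (2 * √c), 0 < ratEval Q (t : ℂ) :=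
    fun t ht => hpos t ht.1 ht.2
  have hQ : Q.num ≠ 0 := by
    intro h
    have ha : 0 < 2 * √c := by positivity
    exact num_eval_ne_zero_of_pos (hpos 0 (by linarith) ha) (by rw [h, eval_zero])
  have hfin := isFiniteMeasure_semicircleOver hc hpos' hQ hpole_right hpole_left
  obtain ⟨T, r, hdeg, hF⟩ := exists_sqrtBranch_div_eq hc hpos' hQ hpole_right hpole_left
  have hpi : (Real.pi : ℂ) ≠ 0 := by exact_mod_cast Real.pi_ne_zero
  have hS : ∀ w ∉ cutInterval c, DifferentiableAt ℂ
      (fun w => 1 / (Real.pi : ℂ) * stieltjesTransform (semicircleOver c Q) w) w :=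
    fun w hw => (differentiableAt_stieltjesTransform hw).const_mul _
  have hSlim : Tendsto (fun w => 1 / (Real.pi : ℂ) * stieltjesTransform (semicircleOver c Q) w)
      (Bornology.cobounded ℂ) (nhds 0) := by
    simpa using tendsto_stieltjesTransform_cobounded.const_mul (1 / (Real.pi : ℂ))
  -- The factor `-(-1)^m` in `q_ζ` turns `(w - ζ)^m` into `(ζ - w)^m` and absorbs the sign from
  -- differentiating `1/(z - w)`.
  have hq : ∀ ζ w : ℂ, (C (-(-1) ^ zeroMult Q ζ) * r ζ).eval w / (ζ - w) ^ zeroMult Q ζ =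
      -((r ζ).eval w / (w - ζ) ^ zeroMult Q ζ) := by
    intro ζ w
    have h1 : ((-1 : ℂ)) ^ zeroMult Q ζ ≠ 0 := by simp
    rw [← neg_sub w ζ, neg_pow (w - ζ), eval_mul, eval_C, neg_mul, neg_div,
      mul_div_mul_left _ _ h1]
  refine ⟨hfin, fun ζ => C (-(-1) ^ zeroMult Q ζ) * r ζ, T, fun ζ hζ => ⟨?_, fun w hw => ?_⟩,
    eventually_eval_eq_circleIntegral hQ hS hSlim hdeg hF, fun w hw hNw => ?_⟩
  · have hm : 0 < zeroMult Q ζ :=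
      (rootMultiplicity_pos hQ).2 (isRoot_of_mem_roots (mem_zerosOff.1 hζ).1)
    refine (natDegree_C_mul_le _ _).trans (Nat.le_sub_one_of_lt ?_)
    by_cases h0 : r ζ = 0
    · rwa [h0, natDegree_zero]
    · exact (natDegree_lt_iff_degree_lt h0).2 (hdeg ζ hζ)
  · rw [iteratedDeriv_sqrtBranch_mul_ratEval hc hQ hS hdeg hF hζ hw, hq, mul_neg]
  · have hcut : w ∉ cutInterval c := by
      rintro ⟨t, -, rfl⟩
      exact hw (Complex.ofReal_im t)
    have h := hF w hcut hNw
    simp only [hq, Finset.sum_neg_distrib]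
    -- This also holds at a pole of `Q`: there the denominator is `0` and both forms of `f/Q` are
    -- `0`.
    rw [ratEval_eq, div_div_eq_mul_div, mul_div_assoc, h]
    field_simp
    ring
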